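/- Let $m,k$ be positive integers. Let $n(m,k)$ be the least $n$ for which there exist sets $S_1,\dots,S_n\subseteq\{1,\dots,m\}$ such that (K) $|S_i|\le k$ for all $i\in\{1,\dots,n\}$; (I) for all integers $a,b$ with $1\le a\le b\le m$ there is an $i\in\{1,\dots,n\}$ such that $|S_i\cap\{a,\dots,b\}|$ is odd. Let $\overline{n}(m,k)$ be the least $n$ for which there exist sets $S_1,\dots,S_n\subseteq\{1,\dots,m\}$ satisfying (K) and (J) for all integers $a,b$ with $1\le a\le b\le m$ there is an $i\in\{1,\dots,n\}$ such that $|S_i\cap\{a,\dots,b\}|$ is odd and $\{a-1,b+1\}\cap S_i=\emptyset$. **Theorem.** There is an absolute constant $C>0$ such that for all positive integers $m,k$ with $k\le m$, $$\max\left\{\frac{m}{k},\ \log_2(m+1)\right\}\ \le\ n(m,k)\ \le\ \overline{n}(m,k)\ \le\ \max\left\{\frac{m}{k}+3\log_2\frac{m}{k}+C,\ \lceil\log_2(m+1)\rceil\right\}.$$ -/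

import Mathlib

/-- Every interval `{a, …, b}` with `1 ≤ a ≤ b ≤ m` meets some `S i` in an odd number of
elements. -/
def OddOnIntervals (m : ℕ) {n : ℕ} (S : Fin n → Finset ℕ) : Prop :=
  ∀ a b : ℕ, 1 ≤ a → a ≤ b → b ≤ m → ∃ i, Odd (S i ∩ Finset.Icc a b).card

/-- Every interval `{a, …, b}` with `1 ≤ a ≤ b ≤ m` meets some `S i` in an odd number of
elements, where moreover the two neighbours `a - 1` and `b + 1` lie outside this `S i`.
(Since `1 ≤ a`, the subtraction is the usual one.) -/
def StronglyOddOnIntervals (m : ℕ) {n : ℕ} (S : Fin n → Finset ℕ) : Prop :=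
  ∀ a b : ℕ, 1 ≤ a → a ≤ b → b ≤ m →
    ∃ i, Odd (S i ∩ Finset.Icc a b).card ∧ a - 1 ∉ S i ∧ b + 1 ∉ S i

/-- The number `n(m,k)`: the least `n` for which there are `n` subsets of `{1, …, m}`, each of
cardinality at most `k`, such that every interval meets one of them in an odd number of
elements. -/
noncomputable def oddNumber (m k : ℕ) : ℕ :=
  sInf {n : ℕ | ∃ S : Fin n → Finset ℕ,
    (∀ i, S i ⊆ Finset.Icc 1 m) ∧ OddOnIntervals m S ∧ ∀ i, (S i).card ≤ k}

/-- The number `n̄(m,k)`: as `oddNumber`, with the stronger requirement on intervals. -/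
noncomputable def strongOddNumber (m k : ℕ) : ℕ :=
  sInf {n : ℕ | ∃ S : Fin n → Finset ℕ,
    (∀ i, S i ⊆ Finset.Icc 1 m) ∧ StronglyOddOnIntervals m S ∧ ∀ i, (S i).card ≤ k}

/-! Lower bounds: singletons force the sets to cover `{1, …, m}`, and the parity vectors of the `m +
1` prefixes are pairwise distinct.

Upper bound: take as sets the positions of each letter in a word. Every nonempty factor must contain
some letter oddly often (the neighbour condition then comes for free, `exists_odd_ne_neighbours`),
and no letter may occur more than `k` times. The ruler sequence has the parity property but is
unbalanced, so its class `t` is shared among the letters `t` and `N + j` with `v₂(j) = t`, in turn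
within each block of length `g`. A factor of length `2^v * odd` with `v ≤ N` has an odd number of
positions of class at least `v`, hence an odd letter. For `v = N + j`, rare exceptions place `N + j`
once per `2^(N+j)` positions without changing classes (`exists_odd_card_grayWord`). Each letter
occurs about once per block (`card_filter_grayWord_le`). -/

/-! ### Counting and parity on intervals. -/

theorem card_filter_Ico_mod_eq {R a : ℕ} (ha : a < R) (x c : ℕ) :
    ((Finset.Ico x (x + R * c)).filter (fun s => s % R = a)).card = c := by
  have hper : Function.Periodic (fun s => s % R = a) R := fun s => by simp
  induction c with
  | zero => simp
  | succ c ih =>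
    have h1 : Finset.Ico x (x + R * (c + 1)) =
        Finset.Ico x (x + R * c) ∪ Finset.Ico (x + R * c) (x + R * c + R) := by
      rw [Finset.Ico_union_Ico_eq_Ico (by omega) (by omega), mul_add, mul_one, add_assoc]
    rw [h1, Finset.filter_union, Finset.card_union_of_disjoint, ih,
      Nat.filter_Ico_card_eq_of_periodic _ _ _ hper, Nat.count_eq_card_filter_range]
    · have : (Finset.range R).filter (fun s => s % R = a) = {a} := by
        ext s
        simp only [Finset.mem_filter, Finset.mem_range, Finset.mem_singleton]
        constructor
        · rintro ⟨h, h'⟩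
          rwa [Nat.mod_eq_of_lt h] at h'
        · rintro rfl
          exact ⟨ha, Nat.mod_eq_of_lt ha⟩
      rw [this, Finset.card_singleton]
    · exact Finset.disjoint_filter_filter (Finset.Ico_disjoint_Ico_consecutive _ _ _)

theorem even_card_filter_Ico_of_periodic {p : ℕ → Prop} [DecidablePred p] {h : ℕ}
    (hp : Function.Periodic p h) (x : ℕ) :
    Even ((Finset.Ico x (x + 2 * h)).filter p).card := by
  have h1 : Finset.Ico x (x + 2 * h) = Finset.Ico x (x + h) ∪ Finset.Ico (x + h) (x + h + h) := by
    rw [Finset.Ico_union_Ico_eq_Ico (by omega) (by omega), two_mul, add_assoc]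
  rw [h1, Finset.filter_union, Finset.card_union_of_disjoint
    (Finset.disjoint_filter_filter (Finset.Ico_disjoint_Ico_consecutive _ _ _)),
    Nat.filter_Ico_card_eq_of_periodic _ _ _ hp, Nat.filter_Ico_card_eq_of_periodic _ _ _ hp]
  exact ⟨_, rfl⟩

theorem exists_odd_card_fiber {T : Finset ℕ} (hT : Odd T.card) (u : ℕ → ℕ) :
    ∃ s ∈ T, Odd (T.filter (fun s' => u s' = u s)).card := by
  by_contra! h
  rw [Finset.card_eq_sum_card_image u T, ← Nat.not_even_iff_odd] at hT
  refine hT (Finset.even_sum _ fun i hi => ?_)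
  obtain ⟨s, hs, rfl⟩ := Finset.mem_image.1 hi
  simpa using h s hs

/-! ### From words to set systems -/

/-- The positions, numbered from `1`, of the letter `i` among the first `m` letters of `u`. -/
def letterPositions (u : ℕ → ℕ) (m i : ℕ) : Finset ℕ :=
  (Finset.Icc 1 m).filter (fun a => u (a - 1) = i)

theorem card_letterPositions_inter (u : ℕ → ℕ) {m a b : ℕ} (i : ℕ) (ha : 1 ≤ a) (hb : b ≤ m) :
    (letterPositions u m i ∩ Finset.Icc a b).card =
      ((Finset.Ico (a - 1) b).filter (fun s => u s = i)).card := by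
  symm
  refine Finset.card_bij (fun s _ => s + 1) ?_ ?_ ?_
  · intro s hs
    simp only [letterPositions, Finset.mem_filter, Finset.mem_Ico, Finset.mem_inter,
      Finset.mem_Icc, Nat.add_sub_cancel] at hs ⊢
    omega
  · intro s _ t _ h
    simpa using h
  · intro c hc
    simp only [letterPositions, Finset.mem_filter, Finset.mem_inter, Finset.mem_Icc] at hc
    refine ⟨c - 1, ?_, by omega⟩
    simp only [Finset.mem_filter, Finset.mem_Ico]
    exact ⟨by omega, hc.1.2⟩

theorem card_filter_Ico_succ_right (u : ℕ → ℕ) (i : ℕ) {x y : ℕ} (h : x ≤ y) :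
    ((Finset.Ico x (y + 1)).filter (fun s => u s = i)).card =
      ((Finset.Ico x y).filter (fun s => u s = i)).card + if u y = i then 1 else 0 := by
  rw [← Finset.insert_Ico_right_eq_Ico_add_one h, Finset.filter_insert]
  split_ifs with h'
  · rw [Finset.card_insert_of_notMem (by simp)]
  · rfl

theorem card_filter_Ico_pred_left (u : ℕ → ℕ) (i : ℕ) {x y : ℕ} (h : x + 1 ≤ y) :
    ((Finset.Ico x y).filter (fun s => u s = i)).card =
      ((Finset.Ico (x + 1) y).filter (fun s => u s = i)).card + if u x = i then 1 else 0 := by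
  rw [← Finset.insert_Ico_add_one_left_eq_Ico h, Finset.filter_insert]
  split_ifs with h'
  · rw [Finset.card_insert_of_notMem (by simp)]
  · rfl

/-- If every nonempty factor of `u` contains a letter an odd number of times, then it contains
such a letter which is different from the two letters adjacent to the factor. -/
theorem exists_odd_ne_neighbours {u : ℕ → ℕ} {m : ℕ}
    (hodd : ∀ x y, x < y → y ≤ m → ∃ i, Odd ((Finset.Ico x y).filter (fun s => u s = i)).card)
    {x y : ℕ} (hxy : x < y) (hy : y ≤ m) :
    ∃ i, Odd ((Finset.Ico x y).filter (fun s => u s = i)).card ∧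
      (1 ≤ x → u (x - 1) ≠ i) ∧ (y + 1 ≤ m → u y ≠ i) := by
  -- If every odd letter equals a neighbour, adjoining one or both neighbours (or none) gives a
  -- factor without odd letters.
  by_contra! hcon
  have hR : y + 1 ≤ m → ∃ i, Odd (((Finset.Ico x y).filter (fun s => u s = i)).card +
      if u y = i then 1 else 0) := fun h => by
    obtain ⟨i, hi⟩ := hodd x (y + 1) (by omega) h
    exact ⟨i, by rwa [card_filter_Ico_succ_right u i hxy.le] at hi⟩
  have hL : 1 ≤ x → ∃ i, Odd (((Finset.Ico x y).filter (fun s => u s = i)).card +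
      if u (x - 1) = i then 1 else 0) := fun h => by
    obtain ⟨i, hi⟩ := hodd (x - 1) y (by omega) hy
    rw [card_filter_Ico_pred_left u i (by omega), Nat.sub_add_cancel h] at hi
    exact ⟨i, hi⟩
  have hLR : 1 ≤ x → y + 1 ≤ m → ∃ i, Odd (((Finset.Ico x y).filter (fun s => u s = i)).card +
      (if u (x - 1) = i then 1 else 0) + if u y = i then 1 else 0) := fun h h' => by
    obtain ⟨i, hi⟩ := hodd (x - 1) (y + 1) (by omega) h'
    rw [card_filter_Ico_succ_right u i (by omega), card_filter_Ico_pred_left u i (by omega),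
      Nat.sub_add_cancel h] at hi
    exact ⟨i, hi⟩
  obtain ⟨i₀, hi₀⟩ := hodd x y hxy hy
  generalize hF : (fun i => ((Finset.Ico x y).filter (fun s => u s = i)).card) = F
  have hF' : ∀ i, ((Finset.Ico x y).filter (fun s => u s = i)).card = F i := fun i => by rw [← hF]
  simp only [hF', Nat.odd_iff] at hcon hR hL hLR hi₀
  clear hF hF' hodd
  by_cases hx : 1 ≤ x <;> by_cases hy' : y + 1 ≤ m
  · have h1 : ∀ i, F i % 2 = 1 → u (x - 1) = i ∨ u y = i := by grind
    obtain ⟨i, hi⟩ := hR hy'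
    obtain ⟨j, hj⟩ := hL hx
    obtain ⟨l, hl⟩ := hLR hx hy'
    by_cases hc : F (u (x - 1)) % 2 = 1 <;> by_cases hc' : F (u y) % 2 = 1 <;> grind
  · obtain ⟨i, hi⟩ := hL hx
    grind
  · obtain ⟨i, hi⟩ := hR hy'
    grind
  · grind

theorem stronglyOdd_of_word {u : ℕ → ℕ} {m n : ℕ} (hu : ∀ s, u s < n)
    (hodd : ∀ x y, x < y → y ≤ m → ∃ i, Odd ((Finset.Ico x y).filter (fun s => u s = i)).card) :
    StronglyOddOnIntervals m (fun i : Fin n => letterPositions u m i) := by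
  intro a b ha hab hb
  obtain ⟨i, hi, h1, h2⟩ := exists_odd_ne_neighbours hodd (x := a - 1) (y := b) (by omega) hb
  have hin : i < n := by
    obtain ⟨s, hs⟩ := Finset.card_pos.1 hi.pos
    rw [← (Finset.mem_filter.1 hs).2]
    exact hu s
  refine ⟨⟨i, hin⟩, ?_, ?_, ?_⟩
  · rwa [card_letterPositions_inter u i ha hb]
  · simp only [letterPositions, Finset.mem_filter, Finset.mem_Icc, not_and]
    intro h
    exact h1 (by omega)
  · simp only [letterPositions, Finset.mem_filter, Finset.mem_Icc, not_and, Nat.add_sub_cancel]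
    intro h
    exact h2 h.2

/-! ### Lower bounds -/

theorem StronglyOddOnIntervals.oddOnIntervals {m n : ℕ} {S : Fin n → Finset ℕ}
    (h : StronglyOddOnIntervals m S) : OddOnIntervals m S := fun a b ha hab hb =>
  let ⟨i, hi⟩ := h a b ha hab hb
  ⟨i, hi.1⟩

theorem OddOnIntervals.le_mul {m n k : ℕ} {S : Fin n → Finset ℕ}
    (h : OddOnIntervals m S) (hk : ∀ i, (S i).card ≤ k) : m ≤ n * k := by
  have hsub : Finset.Icc 1 m ⊆ Finset.univ.biUnion S := fun a ha => by
    obtain ⟨i, hi⟩ := h a a (Finset.mem_Icc.1 ha).1 le_rfl (Finset.mem_Icc.1 ha).2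
    obtain ⟨b, hb⟩ := Finset.card_pos.1 hi.pos
    simp only [Finset.Icc_self, Finset.mem_inter, Finset.mem_singleton] at hb
    exact Finset.mem_biUnion.2 ⟨i, Finset.mem_univ _, hb.2 ▸ hb.1⟩
  calc m = (Finset.Icc 1 m).card := by simp
    _ ≤ (Finset.univ.biUnion S).card := Finset.card_le_card hsub
    _ ≤ (Finset.univ : Finset (Fin n)).card * k :=
      Finset.card_biUnion_le_card_mul _ _ _ fun i _ => hk i
    _ = n * k := by simp

/-- Two prefixes with equal parity vectors would differ by an interval meeting every set evenly. -/
theorem OddOnIntervals.add_one_le_two_pow {m n : ℕ} {S : Fin n → Finset ℕ}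
    (h : OddOnIntervals m S) : m + 1 ≤ 2 ^ n := by
  let f : Fin (m + 1) → (Fin n → Bool) := fun x i => decide (Even (S i ∩ Finset.Icc 1 x).card)
  have hlt : ∀ x y : Fin (m + 1), x < y → f x ≠ f y := fun x y hxy hf => by
    obtain ⟨i, hi⟩ := h (x + 1) y (by omega) hxy (by omega)
    have h1 : S i ∩ Finset.Icc 1 (y : ℕ) =
        (S i ∩ Finset.Icc 1 (x : ℕ)) ∪ (S i ∩ Finset.Icc ((x : ℕ) + 1) y) := by
      have hxy' : (x : ℕ) < y := hxy
      ext a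
      simp only [Finset.mem_inter, Finset.mem_union, Finset.mem_Icc]
      grind
    have h2 : Disjoint (S i ∩ Finset.Icc 1 (x : ℕ)) (S i ∩ Finset.Icc ((x : ℕ) + 1) y) := by
      rw [Finset.disjoint_left]
      intro a
      simp only [Finset.mem_inter, Finset.mem_Icc]
      omega
    have h3 := congrFun hf i
    simp only [f, decide_eq_decide] at h3
    rw [h1, Finset.card_union_of_disjoint h2, Nat.even_add] at h3
    exact Nat.not_even_iff_odd.2 hi (by tauto)
  have hinj : Function.Injective f := fun x y hf => by
    rcases lt_trichotomy x y with hl | he | hl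
    · exact (hlt x y hl hf).elim
    · exact he
    · exact (hlt y x hl hf.symm).elim
  simpa using Fintype.card_le_of_injective f hinj

theorem padicValNat_two_eq_iff {x t : ℕ} (hx : x ≠ 0) :
    padicValNat 2 x = t ↔ x % 2 ^ (t + 1) = 2 ^ t := by
  have h1 : padicValNat 2 x = t ↔ 2 ^ t ∣ x ∧ ¬ 2 ^ (t + 1) ∣ x := by
    rw [padicValNat_dvd_iff_le hx, padicValNat_dvd_iff_le hx]
    omega
  rw [h1]
  have h2 := Nat.div_add_mod x (2 ^ (t + 1))
  have h3 : x % 2 ^ (t + 1) < 2 ^ (t + 1) := Nat.mod_lt _ (by positivity)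
  constructor
  · rintro ⟨ha, hb⟩
    have hc : 2 ^ t ∣ x % 2 ^ (t + 1) := (Nat.dvd_mod_iff (pow_dvd_pow 2 (Nat.le_succ t))).2 ha
    obtain ⟨c, hc⟩ := hc
    rw [hc, pow_succ] at h3
    have hc2 : c < 2 := Nat.lt_of_mul_lt_mul_left h3
    have hc0 : c ≠ 0 := fun h0 => hb (Nat.dvd_of_mod_eq_zero (by rw [hc, h0, mul_zero]))
    have : c = 1 := by omega
    rw [hc, this, mul_one]
  · intro h
    refine ⟨(Nat.dvd_mod_iff (pow_dvd_pow 2 (Nat.le_succ t))).1 (h ▸ dvd_rfl), fun hd => ?_⟩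
    rw [Nat.mod_eq_zero_of_dvd hd] at h
    exact (by positivity : 2 ^ t ≠ 0) h.symm

/-! ### The word -/

/-- The regular letter at a residue `r` modulo `2 ^ N`: the class `t` of `r` is given by the ruler
sequence, and the occurrences of this class within a block of length `g` get distinct letters. -/
def regularLetter (N g r : ℕ) : ℕ :=
  if r % g < 2 ^ (padicValNat 2 (r + 1) + 1) then padicValNat 2 (r + 1)
  else N + (2 ^ (padicValNat 2 (r + 1) + 1) * (r % g / 2 ^ (padicValNat 2 (r + 1) + 1)) -
    2 ^ padicValNat 2 (r + 1))

/-- The times at which the letter `N + j` replaces the regular letter. -/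
def IsException (N j s : ℕ) : Prop :=
  s % 2 ^ (N + j) = 2 ^ (N + j - 1) + (2 ^ padicValNat 2 j - 1)

open Classical in
/-- A word over the letters `0, …, N + M`. -/
noncomputable def grayWord (N g M s : ℕ) : ℕ :=
  if h : ∃ j, (1 ≤ j ∧ j ≤ M) ∧ IsException N j s then N + h.choose
  else regularLetter N g (s % 2 ^ N)

/-- The class of a letter. -/
def letterClass (N i : ℕ) : ℕ := if i ≤ N then i else padicValNat 2 (i - N)

/-! ### Regular letters and their classes. -/

theorem padicValNat_two_le_of_lt {N r : ℕ} (hr : r < 2 ^ N) : padicValNat 2 (r + 1) ≤ N := by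
  have h1 : 2 ^ padicValNat 2 (r + 1) ≤ r + 1 := Nat.le_of_dvd (by omega) pow_padicValNat_dvd
  exact (Nat.pow_le_pow_iff_right (by norm_num : 1 < 2)).1 (h1.trans hr)

theorem two_pow_padicValNat_le {j : ℕ} (hj : 1 ≤ j) : 2 ^ padicValNat 2 j ≤ j :=
  Nat.le_of_dvd hj pow_padicValNat_dvd

theorem regularLetter_of_lt {N g r : ℕ} (h : r % g < 2 ^ (padicValNat 2 (r + 1) + 1)) :
    regularLetter N g r = padicValNat 2 (r + 1) := if_pos h

theorem regularLetter_of_le {N g r : ℕ} (h : 2 ^ (padicValNat 2 (r + 1) + 1) ≤ r % g) :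
    ∃ q, r % g / 2 ^ (padicValNat 2 (r + 1) + 1) = q + 1 ∧
      regularLetter N g r = N + 2 ^ padicValNat 2 (r + 1) * (2 * q + 1) := by
  have hq : 0 < r % g / 2 ^ (padicValNat 2 (r + 1) + 1) := Nat.div_pos h (by positivity)
  obtain ⟨q, hq⟩ := Nat.exists_eq_succ_of_ne_zero hq.ne'
  refine ⟨q, hq, ?_⟩
  rw [regularLetter, if_neg (not_lt.2 h), hq, pow_succ]
  congr 1
  refine Nat.sub_eq_of_eq_add ?_
  simp only [Nat.succ_eq_add_one]
  ring

theorem padicValNat_two_pow_mul_odd (t q : ℕ) : padicValNat 2 (2 ^ t * (2 * q + 1)) = t := by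
  rw [padicValNat.mul (by positivity) (by omega), padicValNat.prime_pow,
    padicValNat.eq_zero_of_not_dvd (by omega), add_zero]

theorem letterClass_regularLetter {N g r : ℕ} (hr : r < 2 ^ N) :
    letterClass N (regularLetter N g r) = padicValNat 2 (r + 1) := by
  rcases lt_or_ge (r % g) (2 ^ (padicValNat 2 (r + 1) + 1)) with h | h
  · rw [regularLetter_of_lt h, letterClass, if_pos (padicValNat_two_le_of_lt hr)]
  · obtain ⟨q, -, hq⟩ := regularLetter_of_le (N := N) h
    have hpos : 0 < 2 ^ padicValNat 2 (r + 1) * (2 * q + 1) := by positivity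
    rw [hq, letterClass, if_neg (by omega), Nat.add_sub_cancel_left, padicValNat_two_pow_mul_odd]

theorem regularLetter_lt {N g r : ℕ} (hg : 0 < g) (hr : r < 2 ^ N) :
    regularLetter N g r < N + 1 + g := by
  rcases lt_or_ge (r % g) (2 ^ (padicValNat 2 (r + 1) + 1)) with h | h
  · rw [regularLetter_of_lt h]
    have := padicValNat_two_le_of_lt hr
    omega
  · rw [regularLetter, if_neg (not_lt.2 h)]
    have h1 := Nat.mul_div_le (r % g) (2 ^ (padicValNat 2 (r + 1) + 1))
    have h2 := Nat.mod_lt r hg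
    have h3 := Nat.sub_le (2 ^ (padicValNat 2 (r + 1) + 1) *
      (r % g / 2 ^ (padicValNat 2 (r + 1) + 1))) (2 ^ padicValNat 2 (r + 1))
    omega

/-- The letter determines the class `t` and the quotient of `r % g` by `2^(t+1)`; within a block,
positions of class `t` agree modulo `2^(t+1)`. -/
theorem regularLetter_injOn_block {N g r r' : ℕ} (hr : r < 2 ^ N) (hr' : r' < 2 ^ N)
    (hblock : r / g = r' / g) (h : regularLetter N g r = regularLetter N g r') : r = r' := by
  have ht : padicValNat 2 (r + 1) = padicValNat 2 (r' + 1) := by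
    rw [← letterClass_regularLetter (g := g) hr, h, letterClass_regularLetter hr']
  have hle := padicValNat_two_le_of_lt hr
  have hq : r % g / 2 ^ (padicValNat 2 (r + 1) + 1) = r' % g / 2 ^ (padicValNat 2 (r + 1) + 1) := by
    rcases lt_or_ge (r % g) (2 ^ (padicValNat 2 (r + 1) + 1)) with h1 | h1 <;>
    rcases lt_or_ge (r' % g) (2 ^ (padicValNat 2 (r' + 1) + 1)) with h2 | h2
    · rw [Nat.div_eq_of_lt h1, Nat.div_eq_of_lt (ht ▸ h2)]
    · obtain ⟨q, -, hq⟩ := regularLetter_of_le (N := N) h2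
      rw [regularLetter_of_lt h1, hq] at h
      have hpos : 0 < 2 ^ padicValNat 2 (r' + 1) * (2 * q + 1) := by positivity
      omega
    · obtain ⟨q, -, hq⟩ := regularLetter_of_le (N := N) h1
      rw [regularLetter_of_lt h2, hq] at h
      have hpos : 0 < 2 ^ padicValNat 2 (r + 1) * (2 * q + 1) := by positivity
      omega
    · obtain ⟨q, hq1, hq⟩ := regularLetter_of_le (N := N) h1
      obtain ⟨q', hq1', hq'⟩ := regularLetter_of_le (N := N) h2
      rw [hq, hq', ← ht] at h
      have h3 := Nat.eq_of_mul_eq_mul_left (by positivity) (Nat.add_left_cancel h)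
      rw [← ht] at hq1'
      omega
  have e1 := (padicValNat_two_eq_iff (Nat.succ_ne_zero r)).1 rfl
  have e2 := (padicValNat_two_eq_iff (Nat.succ_ne_zero r')).1 ht.symm
  have hmod : r % g ≡ r' % g [MOD 2 ^ (padicValNat 2 (r + 1) + 1)] := by
    have h1 : r + 1 ≡ r' + 1 [MOD 2 ^ (padicValNat 2 (r + 1) + 1)] := e1.trans e2.symm
    have h2 := Nat.ModEq.add_right_cancel' 1 h1
    refine Nat.ModEq.add_left_cancel' (g * (r / g)) ?_
    rwa [Nat.div_add_mod, hblock, Nat.div_add_mod]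
  have hp : r % g = r' % g := by
    rw [← Nat.div_add_mod (r % g) (2 ^ (padicValNat 2 (r + 1) + 1)), hq, hmod, Nat.div_add_mod]
  rw [← Nat.div_add_mod r g, hblock, hp, Nat.div_add_mod]

/-! ### Exceptional positions. -/

theorem IsException.mod_two_pow {N j s : ℕ} (hj : 1 ≤ j) (hjN : j < 2 ^ N)
    (h : IsException N j s) : s % 2 ^ N = 2 ^ padicValNat 2 j - 1 := by
  have h1 := two_pow_padicValNat_le hj
  rw [← Nat.mod_mod_of_dvd s (pow_dvd_pow 2 (Nat.le_add_right N j)), h,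
    Nat.add_mod, Nat.mod_eq_zero_of_dvd (pow_dvd_pow 2 (by omega)), zero_add, Nat.mod_mod,
    Nat.mod_eq_of_lt (by omega)]

/-- Among the binary digits of `s` from place `N` upwards, the lowest 1 is at place `N + j - 1`, so
`s` determines `j`. -/
theorem IsException.unique {N i j s : ℕ} (hi : 1 ≤ i) (hj : 1 ≤ j) (hjN : j < 2 ^ N)
    (hiN : i < 2 ^ N) (h : IsException N i s) (h' : IsException N j s) : i = j := by
  have key : ∀ i j : ℕ, 1 ≤ i → 1 ≤ j → j < 2 ^ N → IsException N i s → IsException N j s →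
      ¬ i < j := by
    intro i j hi hj hjN h h' hij
    have h1 := two_pow_padicValNat_le hj
    have h2 : 2 ^ N ≤ 2 ^ (N + i - 1) := Nat.pow_le_pow_right (by norm_num) (by omega)
    have h3 : 2 ^ (N + i - 1) ≤ 2 ^ (N + i) := Nat.pow_le_pow_right (by norm_num) (by omega)
    have h4 : s % 2 ^ (N + i) = 2 ^ padicValNat 2 j - 1 := by
      rw [← Nat.mod_mod_of_dvd s (pow_dvd_pow 2 (by omega : N + i ≤ N + j)), h', Nat.add_mod,
        Nat.mod_eq_zero_of_dvd (pow_dvd_pow 2 (by omega)), zero_add, Nat.mod_mod,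
        Nat.mod_eq_of_lt (by omega)]
    unfold IsException at h
    omega
  have h1 := key i j hi hj hjN h h'
  have h2 := key j i hj hi hiN h' h
  omega

theorem IsException.two_pow_le {N j s : ℕ} (hj : 1 ≤ j) (h : IsException N j s) : 2 ^ N ≤ s := by
  have h1 : 2 ^ N ≤ 2 ^ (N + j - 1) := Nat.pow_le_pow_right (by norm_num) (by omega)
  have h2 := Nat.mod_le s (2 ^ (N + j))
  unfold IsException at h
  omega

theorem IsException.padicValNat_mod {N j s : ℕ} (hj : 1 ≤ j) (hjN : j < 2 ^ N)
    (h : IsException N j s) : padicValNat 2 (s % 2 ^ N + 1) = padicValNat 2 j := by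
  rw [h.mod_two_pow hj hjN, Nat.sub_add_cancel Nat.one_le_two_pow, padicValNat.prime_pow]

/-- The residue `2^t - 1` stays below `2^(t+1)`. Hence exceptions overwrite only letters at most
`N`, and the regular occurrences of `N + j` remain periodic. -/
theorem IsException.regularLetter_le {N j s : ℕ} (g : ℕ) (hj : 1 ≤ j) (hjN : j < 2 ^ N)
    (h : IsException N j s) : regularLetter N g (s % 2 ^ N) ≤ N := by
  rw [regularLetter_of_lt]
  · exact padicValNat_two_le_of_lt (Nat.mod_lt _ (by positivity))
  · rw [h.padicValNat_mod hj hjN]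
    refine (Nat.mod_le _ _).trans_lt ?_
    rw [h.mod_two_pow hj hjN, pow_succ]
    have : 0 < 2 ^ padicValNat 2 j := by positivity
    omega

section grayWord

variable {N g M : ℕ}

theorem grayWord_of_isException (hM : M < 2 ^ N) {j s : ℕ} (hj : 1 ≤ j) (hjM : j ≤ M)
    (h : IsException N j s) : grayWord N g M s = N + j := by
  have hex : ∃ j, (1 ≤ j ∧ j ≤ M) ∧ IsException N j s := ⟨j, ⟨hj, hjM⟩, h⟩
  rw [grayWord, dif_pos hex]
  obtain ⟨⟨h1, h2⟩, h3⟩ := hex.choose_spec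
  rw [h3.unique h1 hj (by omega) (by omega) h]

theorem grayWord_of_not {s : ℕ} (h : ¬ ∃ j, (1 ≤ j ∧ j ≤ M) ∧ IsException N j s) :
    grayWord N g M s = regularLetter N g (s % 2 ^ N) := dif_neg h

theorem grayWord_eq_add_iff (hM : M < 2 ^ N) {j s : ℕ} (hj : 1 ≤ j) (hjM : j ≤ M) :
    grayWord N g M s = N + j ↔
      IsException N j s ∨ regularLetter N g (s % 2 ^ N) = N + j := by
  by_cases hex : ∃ i, (1 ≤ i ∧ i ≤ M) ∧ IsException N i s
  · obtain ⟨i, ⟨h1, h2⟩, h3⟩ := hex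
    have h4 := h3.regularLetter_le g h1 (by omega)
    rw [grayWord_of_isException hM h1 h2 h3]
    constructor
    · intro h
      obtain rfl : i = j := by omega
      exact Or.inl h3
    · rintro (h | h)
      · rw [h3.unique h1 hj (by omega) (by omega) h]
      · omega
  · rw [grayWord_of_not hex]
    exact ⟨Or.inr, fun h => h.resolve_left fun h' => hex ⟨j, ⟨hj, hjM⟩, h'⟩⟩

theorem grayWord_lt (hM : M < 2 ^ N) (hg : 0 < g) (hgM : g ≤ M) (s : ℕ) :
    grayWord N g M s < N + 1 + M := by
  by_cases hex : ∃ i, (1 ≤ i ∧ i ≤ M) ∧ IsException N i s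
  · obtain ⟨i, ⟨h1, h2⟩, h3⟩ := hex
    rw [grayWord_of_isException hM h1 h2 h3]
    omega
  · rw [grayWord_of_not hex]
    have := regularLetter_lt (N := N) (r := s % 2 ^ N) hg (Nat.mod_lt _ (by positivity))
    omega

theorem letterClass_grayWord (hM : M < 2 ^ N) (s : ℕ) :
    letterClass N (grayWord N g M s) = padicValNat 2 (s % 2 ^ N + 1) := by
  by_cases hex : ∃ i, (1 ≤ i ∧ i ≤ M) ∧ IsException N i s
  · obtain ⟨i, ⟨h1, h2⟩, h3⟩ := hex
    rw [grayWord_of_isException hM h1 h2 h3, h3.padicValNat_mod h1 (by omega), letterClass,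
      if_neg (by omega), Nat.add_sub_cancel_left]
  · rw [grayWord_of_not hex, letterClass_regularLetter (Nat.mod_lt _ (by positivity))]

theorem le_letterClass_grayWord_iff (hM : M < 2 ^ N) {v : ℕ} (hv : v ≤ N) (s : ℕ) :
    v ≤ letterClass N (grayWord N g M s) ↔ s % 2 ^ v = 2 ^ v - 1 := by
  have hpos : 0 < 2 ^ v := by positivity
  rw [letterClass_grayWord hM, ← padicValNat_dvd_iff_le (Nat.succ_ne_zero _),
    ← Nat.mod_mod_of_dvd s (pow_dvd_pow 2 hv)]
  generalize s % 2 ^ N = r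
  have h2 := Nat.mod_lt r hpos
  constructor
  · intro h
    have h1 : 2 ^ v ∣ r % 2 ^ v + 1 := by
      rw [← Nat.div_add_mod r (2 ^ v), Nat.succ_eq_add_one, add_assoc] at h
      exact (Nat.dvd_add_right (dvd_mul_right _ _)).1 h
    have h3 := Nat.le_of_dvd (by omega) h1
    omega
  · intro h
    rw [← Nat.div_add_mod r (2 ^ v), Nat.succ_eq_add_one, add_assoc, h, Nat.sub_add_cancel hpos]
    exact (Nat.dvd_add_right (dvd_mul_right _ _)).2 dvd_rfl

end grayWord

/-! ### Parity and size of the letter counts. -/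

section grayWord

variable {N g M : ℕ}

theorem exists_odd_card_grayWord (hM : M < 2 ^ N) {x y : ℕ} (hxy : x < y)
    (hlt : y - x < 2 ^ (N + 1 + M)) :
    ∃ i, Odd ((Finset.Ico x y).filter (fun s => grayWord N g M s = i)).card := by
  obtain ⟨v, c, hc, hd⟩ := Nat.exists_eq_two_pow_mul_odd (n := y - x) (by omega)
  obtain rfl : y = x + 2 ^ v * c := by omega
  have hpos : 0 < 2 ^ v := by positivity
  rcases le_or_gt v N with hv | hv
  -- These positions are those of class at least `v`, a union of full letter fibres.
  · have hT : Odd ((Finset.Ico x (x + 2 ^ v * c)).filter (fun s => s % 2 ^ v = 2 ^ v - 1)).card := by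
      rwa [card_filter_Ico_mod_eq (by omega)]
    obtain ⟨s, hs, hodd⟩ := exists_odd_card_fiber hT (grayWord N g M)
    refine ⟨grayWord N g M s, ?_⟩
    rw [Finset.filter_filter] at hodd
    convert hodd using 2
    refine Finset.filter_congr fun s' _ => ⟨fun h => ⟨?_, h⟩, fun h => h.2⟩
    rw [← le_letterClass_grayWord_iff (g := g) hM hv, h, le_letterClass_grayWord_iff hM hv]
    exact (Finset.mem_filter.1 hs).2
  · obtain ⟨j, rfl⟩ := Nat.exists_eq_add_of_lt hv
    have hle : 2 ^ (N + j + 1) ≤ 2 ^ (N + j + 1) * c := Nat.le_mul_of_pos_right _ hc.pos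
    have hjM : N + j + 1 < N + 1 + M :=
      (Nat.pow_lt_pow_iff_right (by norm_num : 1 < 2)).1 (by omega)
    have hj : j + 1 ≤ M := by omega
    have hj1 : 1 ≤ j + 1 := by omega
    refine ⟨N + (j + 1), ?_⟩
    classical
    have h1 : (Finset.Ico x (x + 2 ^ (N + j + 1) * c)).filter
        (fun s => grayWord N g M s = N + (j + 1)) =
        (Finset.Ico x (x + 2 ^ (N + j + 1) * c)).filter (IsException N (j + 1)) ∪
        (Finset.Ico x (x + 2 ^ (N + j + 1) * c)).filter
          (fun s => regularLetter N g (s % 2 ^ N) = N + (j + 1)) := by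
      rw [← Finset.filter_or]
      exact Finset.filter_congr fun s _ => grayWord_eq_add_iff hM hj1 hj
    have h2 : Disjoint ((Finset.Ico x (x + 2 ^ (N + j + 1) * c)).filter (IsException N (j + 1)))
        ((Finset.Ico x (x + 2 ^ (N + j + 1) * c)).filter
          (fun s => regularLetter N g (s % 2 ^ N) = N + (j + 1))) := by
      refine Finset.disjoint_filter.2 fun s _ h h' => ?_
      have := h.regularLetter_le g hj1 (by omega)
      omega
    have h3 : ((Finset.Ico x (x + 2 ^ (N + j + 1) * c)).filter (IsException N (j + 1))).card = c := by
      have h4 := two_pow_padicValNat_le hj1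
      have h5 : 2 ^ N ≤ 2 ^ (N + j) := Nat.pow_le_pow_right (by norm_num) (by omega)
      have h6 := card_filter_Ico_mod_eq (R := 2 ^ (N + j + 1))
        (a := 2 ^ (N + j) + (2 ^ padicValNat 2 (j + 1) - 1)) (by rw [pow_succ]; omega) x c
      refine Eq.trans (congrArg Finset.card ?_) h6
      ext s
      simp only [Finset.mem_filter]
      exact Iff.rfl
    -- The factor consists of an even number of periods `2^N`, so regular occurrences cancel modulo
    -- 2 and only the `c` exceptions count.
    have h7 : Even ((Finset.Ico x (x + 2 ^ (N + j + 1) * c)).filter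
        (fun s => regularLetter N g (s % 2 ^ N) = N + (j + 1))).card := by
      have h8 : 2 ^ (N + j + 1) * c = 2 * (2 ^ j * c * 2 ^ N) := by ring
      rw [h8]
      refine even_card_filter_Ico_of_periodic (fun s => ?_) x
      simp only [Nat.add_mul_mod_self_right]
    rw [h1, Finset.card_union_of_disjoint h2, h3]
    exact hc.add_even h7

/-- Occurrences of one letter get distinct slots, and slot `q` is used no earlier than position `q *
(g - 1)`. The loss from `g` to `g - 1` pays for partial blocks and exceptions. -/
theorem card_filter_grayWord_le (hM : M < 2 ^ N) (hg : 1 ≤ g) (hgN : 2 * g * g ≤ 2 ^ N)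
    {m k : ℕ} (hmk : m ≤ k * (g - 1)) (i : ℕ) :
    ((Finset.Ico 0 m).filter (fun s => grayWord N g M s = i)).card ≤ k := by
  classical
  set P := 2 ^ N with hP
  obtain ⟨c, hc⟩ : ∃ c, c = P / g + 2 := ⟨_, rfl⟩
  have hc2 : 2 ≤ c := hc ▸ Nat.le_add_left _ _
  have hPpos : 0 < P := by positivity
  have hcP : c * (g - 1) ≤ P := by
    have h1 : 2 * g ≤ P / g := (Nat.le_div_iff_mul_le hg).2 hgN
    have h2 := Nat.div_mul_le_self P g
    obtain ⟨e, rfl⟩ : ∃ e, g = e + 1 := ⟨g - 1, by omega⟩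
    rw [hc, Nat.add_sub_cancel]
    nlinarith
  have hslot : ∀ s, s % P / g + 1 < c := fun s => by
    have : s % P / g ≤ P / g := Nat.div_le_div_right (Nat.mod_lt s hPpos).le
    omega
  let E : ℕ → Prop := fun s => ∃ j, (1 ≤ j ∧ j ≤ M) ∧ IsException N j s
  -- Within a period, the slots `0, …, P / g` are for the blocks of length `g`; the exceptional
  -- position uses the last slot of the preceding period.
  let slot : ℕ → ℕ := fun s => if E s then c * (s / P) - 1 else c * (s / P) + s % P / g
  have hE1 : ∀ s, E s → 1 ≤ s / P := by
    rintro s ⟨j, ⟨hj, -⟩, h⟩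
    exact Nat.div_pos (h.two_pow_le hj) hPpos
  have hslotE : ∀ s, E s → ∃ z, s / P = z + 1 ∧ slot s = c * z + (c - 1) := fun s hs => by
    obtain ⟨z, hz⟩ := Nat.exists_eq_add_of_le' (hE1 s hs)
    refine ⟨z, hz, ?_⟩
    simp only [slot, if_pos hs, hz, mul_add]
    omega
  have hslotR : ∀ s, ¬ E s → slot s = c * (s / P) + s % P / g := fun s hs => if_neg hs
  have hdecode : ∀ a b a' b' : ℕ, b < c → b' < c → c * a + b = c * a' + b' → a = a' ∧ b = b' := by
    intro a b a' b' hb hb' h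
    have h1 := congrArg (· / c) h
    have h2 := congrArg (· % c) h
    simp only [Nat.mul_add_mod, Nat.mod_eq_of_lt hb, Nat.mod_eq_of_lt hb'] at h2
    simp only [Nat.mul_add_div (by omega : 0 < c), Nat.div_eq_of_lt hb, Nat.div_eq_of_lt hb'] at h1
    exact ⟨h1, h2⟩
  rw [← Finset.card_range k]
  refine Finset.card_le_card_of_injOn slot ?_ ?_
  · intro s hs
    simp only [Finset.coe_filter, Finset.mem_Ico, Set.mem_ofPred_eq] at hs
    have hle : slot s ≤ c * (s / P) + s % P / g := by
      simp only [slot]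
      split_ifs
      · exact (Nat.sub_le _ _).trans (Nat.le_add_right _ _)
      · exact le_rfl
    have h1 : slot s * (g - 1) ≤ s := calc
      slot s * (g - 1) ≤ (c * (s / P) + s % P / g) * (g - 1) := Nat.mul_le_mul_right _ hle
      _ = c * (g - 1) * (s / P) + s % P / g * (g - 1) := by ring
      _ ≤ P * (s / P) + s % P / g * g :=
        Nat.add_le_add (Nat.mul_le_mul_right _ hcP) (Nat.mul_le_mul_left _ (Nat.sub_le _ _))
      _ ≤ P * (s / P) + s % P := Nat.add_le_add_left (Nat.div_mul_le_self _ _) _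
      _ = s := Nat.div_add_mod s P
    simp only [Finset.coe_range, Set.mem_Iio]
    exact Nat.lt_of_mul_lt_mul_right (h1.trans_lt (hs.1.2.trans_le hmk))
  · intro s hs s' hs' h
    simp only [Finset.coe_filter, Finset.mem_Ico, Set.mem_ofPred_eq] at hs hs'
    have hletter : grayWord N g M s = grayWord N g M s' := hs.2.trans hs'.2.symm
    have hs1 := hslot s
    have hs1' := hslot s'
    suffices s / P = s' / P ∧ s % P = s' % P by
      rw [← Nat.div_add_mod s P, this.1, this.2, Nat.div_add_mod]
    by_cases hE : E s <;> by_cases hE' : E s'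
    · obtain ⟨z, hz, hz'⟩ := hslotE s hE
      obtain ⟨w, hw, hw'⟩ := hslotE s' hE'
      rw [hz', hw'] at h
      obtain ⟨h1, -⟩ := hdecode _ _ _ _ (by omega) (by omega) h
      obtain ⟨j, ⟨hj, hjM⟩, hex⟩ := hE
      obtain ⟨j', ⟨hj', hjM'⟩, hex'⟩ := hE'
      rw [grayWord_of_isException hM hj hjM hex, grayWord_of_isException hM hj' hjM' hex'] at hletter
      obtain rfl := Nat.add_left_cancel hletter
      exact ⟨by omega, by rw [hex.mod_two_pow hj (by omega), hex'.mod_two_pow hj (by omega)]⟩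
    · obtain ⟨z, hz, hz'⟩ := hslotE s hE
      rw [hz', hslotR s' hE'] at h
      obtain ⟨-, h1⟩ := hdecode _ _ _ _ (by omega) (by omega) h
      omega
    · obtain ⟨w, hw, hw'⟩ := hslotE s' hE'
      rw [hw', hslotR s hE] at h
      obtain ⟨-, h1⟩ := hdecode _ _ _ _ (by omega) (by omega) h
      omega
    · rw [hslotR s hE, hslotR s' hE'] at h
      obtain ⟨h1, h2⟩ := hdecode _ _ _ _ (by omega) (by omega) h
      rw [grayWord_of_not hE, grayWord_of_not hE'] at hletter
      exact ⟨h1, regularLetter_injOn_block (Nat.mod_lt _ hPpos) (Nat.mod_lt _ hPpos) h2 hletter⟩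

end grayWord

/-- The set system given by the word with parameters `N`, `g = M`. -/
theorem exists_stronglyOdd {N M m k : ℕ} (hM1 : 1 ≤ M) (hMN : 2 * M * M ≤ 2 ^ N)
    (hmk : m ≤ k * (M - 1)) (hm : m < 2 ^ (N + 1 + M)) :
    ∃ S : Fin (N + 1 + M) → Finset ℕ, (∀ i, S i ⊆ Finset.Icc 1 m) ∧
      StronglyOddOnIntervals m S ∧ ∀ i, (S i).card ≤ k := by
  have hM : M < 2 ^ N := by nlinarith
  refine ⟨fun i => letterPositions (grayWord N M M) m i, fun i => Finset.filter_subset _ _,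
    stronglyOdd_of_word (grayWord_lt hM hM1 le_rfl)
      fun x y hxy hy => exists_odd_card_grayWord hM hxy (by omega), fun i => ?_⟩
  have h := card_letterPositions_inter (grayWord N M M) (i : ℕ) le_rfl (le_refl m)
  have hsub : letterPositions (grayWord N M M) m i ⊆ Finset.Icc 1 m := Finset.filter_subset _ _
  rw [Finset.inter_eq_left.2 hsub] at h
  exact h.trans_le <| card_filter_grayWord_le hM hM1 hMN hmk i

/-! ### Choice of parameters. -/

theorem four_mul_le_two_pow_add (L : ℕ) : 4 * L ≤ 2 ^ L + 8 := by
  induction L with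
  | zero => simp
  | succ L ih =>
    rw [pow_succ]
    rcases lt_or_ge L 2 with h | h
    · interval_cases L <;> norm_num
    · have := Nat.pow_le_pow_right (by norm_num : 0 < 2) h
      omega

/-- The numbers of sets allowed by the upper bound leave room for `2 * L + 2` sets beyond
`m / k + 1`, where `L` is the binary logarithm of their number. -/
theorem add_two_mul_clog_le {r : ℝ} (hr : 1 ≤ r) {n : ℕ} (hn2 : 2 ≤ n)
    (hn : r + 3 * Real.logb 2 r + 19 < n) : r + 2 * (Nat.clog 2 n : ℕ) + 3 ≤ n := by
  by_contra! hcon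
  obtain ⟨L, hL⟩ := Nat.exists_eq_add_of_le' (Nat.clog_pos (b := 2) (by norm_num) hn2)
  have h1 : 2 ^ L < n := by
    have := Nat.pow_pred_clog_lt_self (b := 2) (by norm_num) (x := n) (by omega)
    simpa [hL] using this
  have h2 : (4 * L : ℝ) ≤ 2 ^ L + 8 := by exact_mod_cast four_mul_le_two_pow_add L
  have h1' : (2 : ℝ) ^ L < n := by exact_mod_cast h1
  rw [hL] at hcon
  push_cast at hcon
  -- In fact `2^L < 2r + 18 ≤ 20r`; 32 is the next power of two.
  have h3 : (2 : ℝ) ^ L < 32 * r := by linarith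
  have h4 : (L : ℝ) ≤ 5 + Real.logb 2 r := by
    have h5 : Real.logb 2 ((2 : ℝ) ^ L) ≤ Real.logb 2 (2 ^ 5 * r) :=
      Real.logb_le_logb_of_le (by norm_num) (by positivity) (by linarith)
    rw [Real.logb_mul (by norm_num) (by positivity), Real.logb_pow, Real.logb_pow,
      Real.logb_self_eq_one (by norm_num)] at h5
    simpa using h5
  have h6 : 0 ≤ Real.logb 2 r := Real.logb_nonneg (by norm_num) hr
  linarith

theorem exists_stronglyOdd_of_lt {m k n : ℕ} (hk : 1 ≤ k) (hkm : k ≤ m) (hmn : m < 2 ^ n)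
    (hn : (m : ℝ) / k + 3 * Real.logb 2 ((m : ℝ) / k) + 19 < n) :
    ∃ S : Fin n → Finset ℕ, (∀ i, S i ⊆ Finset.Icc 1 m) ∧
      StronglyOddOnIntervals m S ∧ ∀ i, (S i).card ≤ k := by
  have hk0 : (0 : ℝ) < k := by exact_mod_cast hk
  have hr : 1 ≤ (m : ℝ) / k := by
    rw [le_div_iff₀ hk0, one_mul]
    exact_mod_cast hkm
  have hlog : 0 ≤ Real.logb 2 ((m : ℝ) / k) := Real.logb_nonneg (by norm_num) hr
  have hn2 : 2 ≤ n := by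
    have : (2 : ℝ) ≤ n := by linarith
    exact_mod_cast this
  have h1 := add_two_mul_clog_le hr hn2 hn
  have hclog := Nat.le_pow_clog (b := 2) (by norm_num) n
  generalize Nat.clog 2 n = L at h1 hclog
  have h2 : 2 * L + 4 ≤ n := by
    have : ((2 * L + 4 : ℕ) : ℝ) ≤ n := by push_cast; linarith
    exact_mod_cast this
  -- With `N = 2L + 1`, the bound `M ≤ n ≤ 2^L` gives `2M² ≤ 2^N`.
  obtain ⟨M, hM⟩ := Nat.exists_eq_add_of_le (show 2 * L + 2 ≤ n by omega)
  obtain rfl : n = (2 * L + 1) + 1 + M := by omega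
  refine exists_stronglyOdd (by omega) ?_ ?_ hmn
  · calc 2 * M * M ≤ 2 * 2 ^ L * 2 ^ L := by gcongr <;> omega
      _ = 2 ^ (2 * L + 1) := by ring
  · have h3 : (m : ℝ) / k ≤ ((M - 1 : ℕ) : ℝ) := by
      rw [Nat.cast_sub (by omega)]
      push_cast at h1 ⊢
      linarith
    rw [div_le_iff₀ hk0, mul_comm] at h3
    exact_mod_cast h3

theorem theorem3p1 :
    ∃ C : ℝ, 0 < C ∧ ∀ m k : ℕ, 1 ≤ k → k ≤ m →
      max ((m : ℝ) / k) (Real.logb 2 (m + 1)) ≤ (oddNumber m k : ℝ) ∧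
      oddNumber m k ≤ strongOddNumber m k ∧
      (strongOddNumber m k : ℝ) ≤
        max ((m : ℝ) / k + 3 * Real.logb 2 ((m : ℝ) / k) + C)
          ((⌈Real.logb 2 ((m : ℝ) + 1)⌉ : ℤ) : ℝ) := by
  -- One more than the 19 of `exists_stronglyOdd_of_lt`, to absorb the floor of `X`.
  refine ⟨20, by norm_num, fun m k hk hkm => ?_⟩
  have hk0 : (0 : ℝ) < k := by exact_mod_cast hk
  have hr : 1 ≤ (m : ℝ) / k := by
    rw [le_div_iff₀ hk0, one_mul]
    exact_mod_cast hkm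
  have hlog : 0 ≤ Real.logb 2 ((m : ℝ) / k) := Real.logb_nonneg (by norm_num) hr
  set X := (m : ℝ) / k + 3 * Real.logb 2 ((m : ℝ) / k) + 20 with hX
  have hceil : 0 ≤ ⌈Real.logb 2 ((m : ℝ) + 1)⌉ :=
    Int.ceil_nonneg (Real.logb_nonneg (by norm_num) (by simp))
  obtain ⟨Y, hY⟩ := Int.eq_ofNat_of_zero_le hceil
  have hmY : m < 2 ^ Y := by
    have h1 : Real.logb 2 ((m : ℝ) + 1) ≤ Y := by
      have := Int.le_ceil (Real.logb 2 ((m : ℝ) + 1))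
      rw [hY] at this
      exact_mod_cast this
    rw [Real.logb_le_iff_le_rpow (by norm_num) (by positivity), Real.rpow_natCast] at h1
    exact_mod_cast h1
  obtain ⟨S, hS⟩ := exists_stronglyOdd_of_lt (n := max ⌊X⌋₊ Y) hk hkm
    (hmY.trans_le (Nat.pow_le_pow_right (by norm_num) (le_max_right _ _))) (by
      have h1 := Nat.lt_floor_add_one X
      have h2 : (⌊X⌋₊ : ℝ) ≤ (max ⌊X⌋₊ Y : ℕ) := by exact_mod_cast le_max_left _ _
      linarith)
  have hupper : strongOddNumber m k ≤ max ⌊X⌋₊ Y := Nat.sInf_le ⟨S, hS⟩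
  -- As `sInf ∅ = 0`, the constructed system is needed to know that the minima are attained.
  obtain ⟨T, hT1, hT2, hT3⟩ := Nat.sInf_mem (s := {n : ℕ | ∃ S : Fin n → Finset ℕ,
    (∀ i, S i ⊆ Finset.Icc 1 m) ∧ StronglyOddOnIntervals m S ∧ ∀ i, (S i).card ≤ k}) ⟨_, S, hS⟩
  have hle : oddNumber m k ≤ strongOddNumber m k :=
    Nat.sInf_le ⟨T, hT1, hT2.oddOnIntervals, hT3⟩
  refine ⟨?_, hle, ?_⟩
  · obtain ⟨R, -, hR2, hR3⟩ : oddNumber m k ∈ {n : ℕ | ∃ S : Fin n → Finset ℕ,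
        (∀ i, S i ⊆ Finset.Icc 1 m) ∧ OddOnIntervals m S ∧ ∀ i, (S i).card ≤ k} :=
      Nat.sInf_mem ⟨_, T, hT1, hT2.oddOnIntervals, hT3⟩
    refine max_le ?_ ?_
    · rw [div_le_iff₀ hk0]
      exact_mod_cast hR2.le_mul hR3
    · rw [Real.logb_le_iff_le_rpow (by norm_num) (by positivity), Real.rpow_natCast]
      exact_mod_cast hR2.add_one_le_two_pow
  · have h1 : (strongOddNumber m k : ℝ) ≤ (max ⌊X⌋₊ Y : ℕ) := by exact_mod_cast hupper
    refine h1.trans ?_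
    rw [hY, Nat.cast_max]
    exact max_le_max (Nat.floor_le (by linarith)) (by simp)
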